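/- Let $G$ be a finite simple graph on $n$ vertices. Let $\tilde\alpha(G)$ be its bipartite independence number, that is, the minimal number $k$ such that there exist positive integers $a$ and $b$ with $a+b=k+1$ with the property that for any two disjoint sets $A,B\subseteq V(G)$ with $|A|=a$ and $|B|=b$ there is an edge of $G$ between $A$ and $B$. If the minimum degree satisfies $\delta(G)\ge\tilde\alpha(G)$, then $G$ is pancyclic, meaning that it contains a cycle of length $\ell$ for every integer $\ell$ with $3\le\ell\le n$, unless $n$ is even and $G$ is isomorphic to the complete bipartite graph $K_{\frac n2,\frac n2}$. -/

import Mathlib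

namespace SimpleGraph

variable {V : Type*}

/-- Between any two disjoint vertex sets of sizes `a` and `b` there is an edge of `G`. -/
def EdgeBetweenDisjoint (G : SimpleGraph V) (a b : ℕ) : Prop :=
  ∀ A B : Finset V, A.card = a → B.card = b → Disjoint A B → ∃ u ∈ A, ∃ v ∈ B, G.Adj u v

/-- The bipartite independence number of `G`: the least `k` for which there are positive integers
`a`, `b` with `a + b = k + 1` such that any two disjoint vertex sets of sizes `a` and `b` are
joined by an edge. -/
noncomputable def bipartiteIndepNum (G : SimpleGraph V) : ℕ :=
  sInf {k : ℕ | ∃ a b : ℕ, 0 < a ∧ 0 < b ∧ a + b = k + 1 ∧ G.EdgeBetweenDisjoint a b}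

/-- For a finite graph the set in the definition of `bipartiteIndepNum` is nonempty, so the
infimum is an attained minimum. -/
theorem bipartiteIndepNum_spec [Fintype V] (G : SimpleGraph V) :
    ∃ a b : ℕ, 0 < a ∧ 0 < b ∧ a + b = G.bipartiteIndepNum + 1 ∧ G.EdgeBetweenDisjoint a b := by
  have hne : {k : ℕ | ∃ a b : ℕ, 0 < a ∧ 0 < b ∧ a + b = k + 1 ∧
      G.EdgeBetweenDisjoint a b}.Nonempty := by
    refine ⟨Fintype.card V + 1, Fintype.card V + 1, 1, by omega, by omega, by omega, ?_⟩
    intro A B hA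
    have := A.card_le_univ
    omega
  exact Nat.sInf_mem hne

/-- A finite graph on `n` vertices is pancyclic if it contains a cycle of length `l` for every
integer `l` with `3 ≤ l ≤ n`. -/
def IsPancyclic [Fintype V] (G : SimpleGraph V) : Prop :=
  ∀ l : ℕ, 3 ≤ l → l ≤ Fintype.card V → ∃ (v : V) (c : G.Walk v v), c.IsCycle ∧ c.length = l

end SimpleGraph

/-! Fix `a`, `b` attaining the minimum, with `b ≤ a`. Every degree is at least `a + b - 1`, so the
neighbours of a vertex can be cut at one shared element into sets of sizes `a` and `b`.

Suppose `G` has a triangle. The proof works with paths `f 1, …, f m` whose first three vertices form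
a triangle (`TriPath`). The triangle gives one unit of slack: `f 1` and `f 2` may be swapped, and `f
2` may be omitted, so that a vertex off the path can be taken in without changing the length. Such
paths exist on every number of vertices from 3 to `|V|` (`TriPath.exists_card`), and one on `m ≥ 4`
vertices yields an `m`-cycle (`TriPath.hasCycle`). Both facts come from Pósa-type rotations.
Neighbours of two suitable vertices are shifted by one along the path and cut at a threshold `p`;
together with vertices off the path they fill disjoint sets of sizes `a` and `b`, and any edge
between these closes the cycle or lengthens the path.

Without triangles, neighbourhoods are independent. This forces all degrees to equal `a + b - 1` and
makes non-adjacency transitive, so `G` is a balanced complete bipartite graph. -/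

namespace SimpleGraph

variable {V : Type*}

/-! ### Paths counted by vertices and confined to a set. -/

/-- There is a path of `G` from `x` to `y` on exactly `n` vertices, all of them in `S`. -/
def HasPath (G : SimpleGraph V) (x y : V) (n : ℕ) (S : Set V) : Prop :=
  ∃ p : G.Walk x y, p.IsPath ∧ p.length + 1 = n ∧ ∀ v ∈ p.support, v ∈ S

namespace HasPath

variable {G : SimpleGraph V} {x y u w : V} {n n' : ℕ} {S S' : Set V}

theorem single (x : V) : G.HasPath x x 1 {x} :=
  ⟨Walk.nil, by simp, by simp, by simp⟩

theorem reverse (h : G.HasPath x y n S) : G.HasPath y x n S := by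
  obtain ⟨p, hp, hl, hS⟩ := h
  exact ⟨p.reverse, hp.reverse, by simpa using hl, by simpa using hS⟩

theorem append (h : G.HasPath x y n S) (h' : G.HasPath u w n' S') (hadj : G.Adj y u)
    (hd : Disjoint S S') : G.HasPath x w (n + n') (S ∪ S') := by
  obtain ⟨p, hp, hl, hS⟩ := h
  obtain ⟨q, hq, hl', hS'⟩ := h'
  refine ⟨p.append (Walk.cons hadj q), ?_, ?_, ?_⟩
  · rw [Walk.isPath_def, Walk.support_append, Walk.support_cons, List.tail_cons,
      List.nodup_append]
    refine ⟨hp.support_nodup, hq.support_nodup, ?_⟩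
    rintro a ha b hb rfl
    exact Set.disjoint_left.1 hd (hS a ha) (hS' a hb)
  · simp only [Walk.length_append, Walk.length_cons]; omega
  · intro v hv
    rw [Walk.support_append, Walk.support_cons, List.tail_cons, List.mem_append] at hv
    exact hv.imp (hS v) (hS' v)

theorem exists_cycle (h : G.HasPath x y n S) (hadj : G.Adj y x) (hn : 3 ≤ n) :
    ∃ (v : V) (c : G.Walk v v), c.IsCycle ∧ c.length = n := by
  obtain ⟨p, hp, hl, -⟩ := h
  refine ⟨y, Walk.cons hadj p, ?_, by simpa using hl⟩
  rw [Walk.cons_isCycle_iff]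
  refine ⟨hp, ?_⟩
  cases p with
  | nil => simp at hl; omega
  | cons h' q =>
    rw [Walk.cons_isPath_iff] at hp
    rw [Walk.edges_cons, List.mem_cons, not_or]
    refine ⟨?_, fun hmem => hp.2 (q.snd_mem_support_of_mem_edges hmem)⟩
    intro heq
    rw [Sym2.eq_iff] at heq
    rcases heq with ⟨h1, -⟩ | ⟨h1, -⟩
    · exact hadj.ne h1
    · subst h1
      have := Walk.length_eq_zero_iff.2 (Walk.isPath_iff_nil.1 hp.1)
      simp at hl; omega

theorem of_seq {f : ℕ → V} {i j : ℕ} (hij : i ≤ j) (hf : Set.InjOn f (Set.Icc i j))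
    (hadj : ∀ t, i ≤ t → t < j → G.Adj (f t) (f (t + 1))) :
    G.HasPath (f i) (f j) (j + 1 - i) (f '' Set.Icc i j) := by
  induction j, hij using Nat.le_induction with
  | base => simpa using single (G := G) (f i)
  | succ j hij ih =>
    have h1 := ih (hf.mono (Set.Icc_subset_Icc_right (Nat.le_succ j)))
      (fun t h1 h2 => hadj t h1 (by omega))
    have h2 := h1.append (single (f (j + 1))) (hadj j hij (by omega)) (by
      rw [Set.disjoint_singleton_right]
      rintro ⟨t, ht, hte⟩
      have := hf ⟨ht.1, by have := ht.2; omega⟩ ⟨by omega, le_rfl⟩ hte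
      have := ht.2
      omega)
    obtain ⟨p, hp, hl, hS⟩ := h2
    refine ⟨p, hp, by omega, fun v hv => ?_⟩
    rcases hS v hv with ⟨t, ht, rfl⟩ | rfl
    · exact ⟨t, ⟨ht.1, by have := ht.2; omega⟩, rfl⟩
    · exact ⟨j + 1, ⟨by omega, le_rfl⟩, rfl⟩

/-- The vertices of a path, listed as a sequence. -/
theorem exists_seq (h : G.HasPath x y n S) :
    ∃ f : ℕ → V, f 0 = x ∧ Set.InjOn f (Set.Iio n) ∧ (∀ i < n, f i ∈ S) ∧
      ∀ i, i + 1 < n → G.Adj (f i) (f (i + 1)) := by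
  obtain ⟨p, hp, hl, hS⟩ := h
  refine ⟨p.getVert, by simp, ?_, ?_, ?_⟩
  · intro i hi j hj hij
    exact hp.getVert_injOn (by simp at hi ⊢; omega) (by simp at hj ⊢; omega) hij
  · intro i _
    exact hS _ (p.getVert_mem_support i)
  · intro i hi
    exact p.adj_getVert_succ (by omega)

end HasPath

/-! ### Paths that start with a triangle. -/

/-- `f 1, …, f m` is a path of `G` whose first three vertices form a triangle. -/
structure TriPath (G : SimpleGraph V) (m : ℕ) (f : ℕ → V) : Prop where
  inj : Set.InjOn f (Set.Icc 1 m)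
  adj : ∀ i, 1 ≤ i → i < m → G.Adj (f i) (f (i + 1))
  le : 3 ≤ m
  tri : G.Adj (f 1) (f 3)

/-- Most extensions below end here: the triangle is kept, possibly with a new vertex in it, and only
the path leaving its third vertex is rerouted. -/
theorem HasPath.exists_triPath {G : SimpleGraph V} {x₁ x₂ x₃ y : V} {n m : ℕ} {S : Set V}
    (h : G.HasPath x₃ y n S) (h12 : G.Adj x₁ x₂) (h13 : G.Adj x₁ x₃) (h23 : G.Adj x₂ x₃)
    (h1 : x₁ ∉ S) (h2 : x₂ ∉ S) (hm : m = n + 2) :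
    ∃ f, G.TriPath m f := by
  have hn : 1 ≤ n := by obtain ⟨p, -, hl, -⟩ := h; omega
  obtain ⟨g, g0, ginj, gS, gadj⟩ := h.exists_seq
  subst hm
  have key : ∀ i, 3 ≤ i → i ≤ n + 2 → g (i - 3) ∈ S := fun i _ _ => gS _ (by omega)
  refine ⟨fun i => if i ≤ 1 then x₁ else if i = 2 then x₂ else g (i - 3), ⟨?_, ?_, by omega, ?_⟩⟩
  · intro i hi j hj hij
    simp only [Set.mem_Icc] at hi hj
    have ki := key i
    have kj := key j
    have hne := h12.ne
    have hg : 3 ≤ i → 3 ≤ j → g (i - 3) = g (j - 3) → i = j := fun a b hh => by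
      have := ginj (by simp; omega) (by simp; omega) hh
      omega
    dsimp only at hij
    split_ifs at hij <;> first | omega | grind
  · intro i hi1 hi2
    rcases (by omega : i = 1 ∨ i = 2 ∨ 3 ≤ i) with rfl | rfl | h3
    · simpa using h12
    · simpa [g0] using h23
    · have := gadj (i - 3) (by omega)
      rw [if_neg (by omega), if_neg (by omega), if_neg (by omega), if_neg (by omega)]
      rwa [show i + 1 - 3 = i - 3 + 1 by omega]
  · simpa [g0] using h13

open Finset

variable {G : SimpleGraph V}

/-- `G` contains a cycle of length `n`. -/
def HasCycle (G : SimpleGraph V) (n : ℕ) : Prop :=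
  ∃ (v : V) (c : G.Walk v v), c.IsCycle ∧ c.length = n

/-- The vertex `z` is not among `f 1, …, f m`. -/
def Avoids (f : ℕ → V) (m : ℕ) (z : V) : Prop := ∀ i, 1 ≤ i → i ≤ m → f i ≠ z

theorem Avoids.notMem {f : ℕ → V} {m i j : ℕ} {z : V} (h : Avoids f m z) (hi : 1 ≤ i)
    (hj : j ≤ m) : z ∉ f '' Set.Icc i j := by
  rintro ⟨t, ht, rfl⟩
  exact h t (hi.trans ht.1) (ht.2.trans hj) rfl

namespace TriPath

variable {m : ℕ} {f : ℕ → V}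

theorem up (hf : G.TriPath m f) {i j : ℕ} (hi : 1 ≤ i) (hij : i ≤ j) (hj : j ≤ m) :
    G.HasPath (f i) (f j) (j + 1 - i) (f '' Set.Icc i j) :=
  HasPath.of_seq hij (hf.inj.mono (Set.Icc_subset_Icc hi hj))
    (fun t h1 h2 => hf.adj t (by omega) (by omega))

theorem down (hf : G.TriPath m f) {i j : ℕ} (hi : 1 ≤ i) (hij : i ≤ j) (hj : j ≤ m) :
    G.HasPath (f j) (f i) (j + 1 - i) (f '' Set.Icc i j) :=
  (hf.up hi hij hj).reverse

theorem disj (hf : G.TriPath m f) {i j i' j' : ℕ} (h : j < i' ∨ j' < i) (hi : 1 ≤ i) (hj : j ≤ m) (hi' : 1 ≤ i')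
    (hj' : j' ≤ m) : Disjoint (f '' Set.Icc i j) (f '' Set.Icc i' j') := by
  rw [Set.disjoint_left]
  rintro _ ⟨t, ht, rfl⟩ ⟨s, hs, hst⟩
  obtain ⟨h1, h2⟩ := ht
  obtain ⟨h3, h4⟩ := hs
  have := hf.inj ⟨by omega, by omega⟩ ⟨by omega, by omega⟩ hst
  omega

theorem notMem (hf : G.TriPath m f) {t i j : ℕ} (h : t < i ∨ j < t) (hi : 1 ≤ i) (hj : j ≤ m) (ht : 1 ≤ t)
    (ht' : t ≤ m) : f t ∉ f '' Set.Icc i j := by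
  rintro ⟨s, ⟨h3, h4⟩, hst⟩
  have := hf.inj ⟨by omega, by omega⟩ ⟨by omega, by omega⟩ hst
  omega

theorem adj12 (hf : G.TriPath m f) : G.Adj (f 1) (f 2) := hf.adj 1 le_rfl (by have := hf.le; omega)
theorem adj23 (hf : G.TriPath m f) : G.Adj (f 2) (f 3) := hf.adj 2 (by omega) (by have := hf.le; omega)

theorem pred (hf : G.TriPath m f) {m' : ℕ} (h : m' ≤ m) (h3 : 3 ≤ m') : G.TriPath m' f :=
  ⟨hf.inj.mono (Set.Icc_subset_Icc_right h), fun i h1 h2 => hf.adj i h1 (by omega), h3, hf.tri⟩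

/-! ### Single edges that close a cycle of length `m` or `m + 1`. -/

theorem hasCycle_of_adj_one (hf : G.TriPath m f) (h : G.Adj (f 1) (f m)) : G.HasCycle m := by
  have h3 := hf.le
  have := (hf.up le_rfl (by omega) le_rfl).exists_cycle h.symm (by omega)
  rwa [Nat.add_sub_cancel] at this

theorem hasCycle_of_adj_two (hf : G.TriPath m f) (h : G.Adj (f 2) (f m)) (hm : 4 ≤ m) : G.HasCycle m := by
  have h1 := ((HasPath.single (f 2)).append (HasPath.single (f 1)) hf.adj12.symm (by
    simpa using hf.adj12.ne')).append (hf.up (i := 3) (by omega) (by omega) le_rfl) hf.tri (by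
    rw [Set.disjoint_union_left, Set.disjoint_singleton_left, Set.disjoint_singleton_left]
    exact ⟨hf.notMem (by omega) (by omega) (by omega) (by omega) (by omega),
      hf.notMem (by omega) (by omega) (by omega) (by omega) (by omega)⟩)
  have := h1.exists_cycle h.symm (by omega)
  rwa [show 1 + 1 + (m + 1 - 3) = m by omega] at this

/-- Rotating both ends, outward. -/
theorem hasCycle_pred_succ (hf : G.TriPath m f) {i j : ℕ} (hi : 1 ≤ i) (hij : i < j) (hj : j < m)
    (hx : G.Adj (f 1) (f (i + 1))) (hy : G.Adj (f m) (f j)) (h : G.Adj (f i) (f (j + 1))) :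
    G.HasCycle m := by
  have h1 := ((hf.down le_rfl hi (by omega)).append (hf.up (i := i + 1) (j := j) (by omega)
    (by omega) (by omega)) hx (hf.disj (by omega) (by omega) (by omega) (by omega)
    (by omega))).append (hf.down (i := j + 1) (j := m) (by omega) (by omega) le_rfl) hy.symm (by
    rw [Set.disjoint_union_left]
    exact ⟨hf.disj (by omega) (by omega) (by omega) (by omega) (by omega),
      hf.disj (by omega) (by omega) (by omega) (by omega) (by omega)⟩)
  have := h1.exists_cycle h.symm (by omega)
  rwa [show i + 1 - 1 + (j + 1 - (i + 1)) + (m + 1 - (j + 1)) = m by omega] at this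

/-- The cycle is `f 1 … f (j-1), f i … f j, f m … f (i+1)`. -/
theorem hasCycle_pred_pred (hf : G.TriPath m f) {i j : ℕ} (hj : 2 ≤ j) (hij : j ≤ i) (hi : i < m)
    (hx : G.Adj (f 1) (f (i + 1))) (hy : G.Adj (f m) (f j)) (h : G.Adj (f (j - 1)) (f i)) :
    G.HasCycle m := by
  have h1 := ((hf.up (i := 1) (j := j - 1) le_rfl (by omega) (by omega)).append
    (hf.down (i := j) (j := i) (by omega)
    (by omega) (by omega)) h (hf.disj (by omega) (by omega) (by omega) (by omega)
    (by omega))).append (hf.down (i := i + 1) (j := m) (by omega) (by omega) le_rfl) hy.symm (by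
    rw [Set.disjoint_union_left]
    exact ⟨hf.disj (by omega) (by omega) (by omega) (by omega) (by omega),
      hf.disj (by omega) (by omega) (by omega) (by omega) (by omega)⟩)
  have := h1.exists_cycle hx.symm (by have := hf.le; omega)
  rwa [show j - 1 + 1 - 1 + (i + 1 - j) + (m + 1 - (i + 1)) = m by omega] at this

/-- The cycle `z, f 1, f 3 … f j, f m … f (j+1)` takes in `z` and leaves out `f 2`; for `j = 2` the
edge from `f m` to `f 2` or `f 1` already closes an `m`-cycle. -/
theorem hasCycle_out_succ (hf : G.TriPath m f) {j : ℕ} {z : V} (hz : Avoids f m z) (hj : 2 ≤ j) (hjm : j < m)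
    (hx : G.Adj (f 1) z) (hy : G.Adj (f m) (f j)) (h : G.Adj z (f (j + 1))) :
    G.HasCycle m := by
  rcases hj.eq_or_lt with rfl | hj
  · rcases (show m = 3 ∨ 4 ≤ m by omega) with rfl | hm
    · exact hf.hasCycle_of_adj_one hf.tri
    · exact hf.hasCycle_of_adj_two hy.symm hm
  have h1 := (((HasPath.single z).append (HasPath.single (f 1)) hx.symm (by
    simpa using hx.ne')).append (hf.up (i := 3) (j := j) (by omega) (by omega) (by omega)) hf.tri
      (by
      rw [Set.disjoint_union_left, Set.disjoint_singleton_left, Set.disjoint_singleton_left]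
      exact ⟨hz.notMem (by omega) (by omega),
        hf.notMem (by omega) (by omega) (by omega) (by omega) (by omega)⟩)).append
      (hf.down (i := j + 1) (j := m) (by omega) (by omega) le_rfl) hy.symm (by
      rw [Set.disjoint_union_left, Set.disjoint_union_left, Set.disjoint_singleton_left,
        Set.disjoint_singleton_left]
      exact ⟨⟨hz.notMem (by omega) (by omega),
        hf.notMem (by omega) (by omega) (by omega) (by omega) (by omega)⟩,
        hf.disj (by omega) (by omega) (by omega) (by omega) (by omega)⟩)
  have := h1.exists_cycle h.symm (by omega)
  rwa [show 1 + 1 + (j + 1 - 3) + (m + 1 - (j + 1)) = m by omega] at this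

/-- Again `w` replaces a triangle vertex: for `i ≥ 3` the cycle is `f i … f 3, f 1, f (i+1) … f m,
w`. -/
theorem hasCycle_pred_out (hf : G.TriPath m f) {i : ℕ} {w : V} (hw : Avoids f m w) (hm : 4 ≤ m) (hi : 1 ≤ i)
    (him : i < m) (hx : G.Adj (f 1) (f (i + 1))) (hy : G.Adj (f m) w) (h : G.Adj (f i) w) :
    G.HasCycle m := by
  rcases (show i + 1 = m ∨ i + 1 < m by omega) with rfl | him'
  · exact hf.hasCycle_of_adj_one hx
  rcases (show i = 1 ∨ i = 2 ∨ 3 ≤ i by omega) with rfl | rfl | h3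
  · have h1 := ((HasPath.single (f 1)).append (hf.up (i := 3) (j := m) (by omega) (by omega)
      le_rfl) hf.tri (by
        rw [Set.disjoint_singleton_left]
        exact hf.notMem (by omega) (by omega) (by omega) (by omega) (by omega))).append
      (HasPath.single w) hy (by
        rw [Set.disjoint_singleton_right]
        rintro (h | h)
        · exact hw 1 le_rfl (by omega) h.symm
        · exact hw.notMem (by omega) (by omega) h)
    have := h1.exists_cycle h.symm (by omega)
    rwa [show 1 + (m + 1 - 3) + 1 = m by omega] at this
  · have h1 := (hf.up (i := 2) (j := m) (by omega) (by omega) le_rfl).append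
      (HasPath.single w) hy (by
        rw [Set.disjoint_singleton_right]
        exact hw.notMem (by omega) (by omega))
    have := h1.exists_cycle h.symm (by omega)
    rwa [show m + 1 - 2 + 1 = m by omega] at this
  · have h1 := (((hf.down (i := 3) (j := i) (by omega) (by omega) (by omega)).append
      (HasPath.single (f 1)) hf.tri.symm (by
        rw [Set.disjoint_singleton_right]
        exact hf.notMem (by omega) (by omega) (by omega) (by omega) (by omega))).append
      (hf.up (i := i + 1) (j := m) (by omega) (by omega) le_rfl) hx (by
        rw [Set.disjoint_union_left, Set.disjoint_singleton_left]
        exact ⟨hf.disj (by omega) (by omega) (by omega) (by omega) (by omega),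
          hf.notMem (by omega) (by omega) (by omega) (by omega) (by omega)⟩)).append
      (HasPath.single w) hy (by
        rw [Set.disjoint_singleton_right]
        rintro ((h | h) | h)
        · exact hw.notMem (by omega) (by omega) h
        · exact hw 1 le_rfl (by omega) h.symm
        · exact hw.notMem (by omega) (by omega) h)
    have := h1.exists_cycle h.symm (by omega)
    rwa [show i + 1 - 3 + 1 + (m + 1 - (i + 1)) + 1 = m by omega] at this

theorem hasCycle_succ_of_out_succ (hf : G.TriPath m f) {j : ℕ} {z : V} (hz : Avoids f m z) (hj : 1 ≤ j) (hjm : j < m)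
    (hx : G.Adj (f 1) z) (hy : G.Adj (f m) (f j)) (h : G.Adj z (f (j + 1))) :
    G.HasCycle (m + 1) := by
  have h1 := ((HasPath.single z).append (hf.up (i := 1) (j := j) le_rfl hj (by omega)) hx.symm (by
      rw [Set.disjoint_singleton_left]
      exact hz.notMem (by omega) (by omega))).append
      (hf.down (i := j + 1) (j := m) (by omega) (by omega) le_rfl) hy.symm (by
      rw [Set.disjoint_union_left, Set.disjoint_singleton_left]
      exact ⟨hz.notMem (by omega) (by omega),
        hf.disj (by omega) (by omega) (by omega) (by omega) (by omega)⟩)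
  have := h1.exists_cycle h.symm (by have := hf.le; omega)
  rwa [show 1 + (j + 1 - 1) + (m + 1 - (j + 1)) = m + 1 by omega] at this

theorem hasCycle_succ_of_common (hf : G.TriPath m f) {w : V} (hw : Avoids f m w) (hx : G.Adj (f 1) w)
    (hy : G.Adj (f m) w) : G.HasCycle (m + 1) := by
  have h3 := hf.le
  have h1 := (hf.up (i := 1) (j := m) le_rfl (by omega) le_rfl).append (HasPath.single w) hy (by
      rw [Set.disjoint_singleton_right]
      exact hw.notMem (by omega) (by omega))
  have := h1.exists_cycle hx.symm (by omega)
  rwa [show m + 1 - 1 + 1 = m + 1 by omega] at this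

/-- Two vertices come in and `f 2` goes out, so the length grows by one only. -/
theorem hasCycle_succ_of_out_out (hf : G.TriPath m f) {z w : V} (hz : Avoids f m z) (hw : Avoids f m w)
    (hx : G.Adj (f 1) z) (hy : G.Adj (f m) w) (h : G.Adj z w) : G.HasCycle (m + 1) := by
  have h3 := hf.le
  have h1 := (((HasPath.single z).append (HasPath.single (f 1)) hx.symm (by
    simpa using hx.ne')).append (hf.up (i := 3) (j := m) (by omega) (by omega) (by omega)) hf.tri
      (by
      rw [Set.disjoint_union_left, Set.disjoint_singleton_left, Set.disjoint_singleton_left]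
      exact ⟨hz.notMem (by omega) (by omega),
        hf.notMem (by omega) (by omega) (by omega) (by omega) (by omega)⟩)).append
      (HasPath.single w) hy (by
      rw [Set.disjoint_singleton_right]
      rintro ((h' | h') | h')
      · exact h.ne' h'
      · exact hw 1 le_rfl (by omega) h'.symm
      · exact hw.notMem (by omega) (by omega) h')
  have := h1.exists_cycle h.symm (by omega)
  rwa [show 1 + 1 + (m + 1 - 3) + 1 = m + 1 by omega] at this

theorem hasCycle_succ_of_pred_out (hf : G.TriPath m f) {i : ℕ} {w : V} (hw : Avoids f m w) (hi : 1 ≤ i)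
    (him : i < m) (hx : G.Adj (f 1) (f (i + 1))) (hy : G.Adj (f m) w) (h : G.Adj (f i) w) :
    G.HasCycle (m + 1) := by
  have h3 := hf.le
  have h1 := ((hf.down (i := 1) (j := i) le_rfl hi (by omega)).append
      (hf.up (i := i + 1) (j := m) (by omega) (by omega) le_rfl) hx
      (hf.disj (by omega) (by omega) (by omega) (by omega) (by omega))).append
      (HasPath.single w) hy (by
        rw [Set.disjoint_singleton_right]
        rintro (h | h)
        · exact hw.notMem (by omega) (by omega) h
        · exact hw.notMem (by omega) (by omega) h)
  have := h1.exists_cycle h.symm (by omega)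
  rwa [show i + 1 - 1 + (m + 1 - (i + 1)) + 1 = m + 1 by omega] at this

end TriPath

/-! ### Applying the edge condition and counting neighbours along a path. -/

theorem EdgeBetweenDisjoint.exists_adj {a b : ℕ} (h : G.EdgeBetweenDisjoint a b) {A B : Finset V}
    (hA : a ≤ #A) (hB : b ≤ #B) (hAB : Disjoint A B) : ∃ u ∈ A, ∃ v ∈ B, G.Adj u v := by
  obtain ⟨A', hA', rfl⟩ := exists_subset_card_eq hA
  obtain ⟨B', hB', rfl⟩ := exists_subset_card_eq hB
  obtain ⟨u, hu, v, hv, huv⟩ := h A' B' rfl rfl (disjoint_of_subset_left hA'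
    (disjoint_of_subset_right hB' hAB))
  exact ⟨u, hA' hu, v, hB' hv, huv⟩

theorem EdgeBetweenDisjoint.symm {a b : ℕ} (h : G.EdgeBetweenDisjoint a b) :
    G.EdgeBetweenDisjoint b a := by
  intro A B hA hB hAB
  obtain ⟨u, hu, v, hv, huv⟩ := h B A hB hA hAB.symm
  exact ⟨v, hv, u, hu, huv.symm⟩

open Classical in
/-- The edge between disjoint sets, when these sets consist of some vertices of a sequence
and some vertices avoiding it. -/
theorem EdgeBetweenDisjoint.exists_adj_seq {a b s m : ℕ} (h : G.EdgeBetweenDisjoint a b)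
    {f : ℕ → V} (hf : Set.InjOn f (Set.Icc s m)) {I J : Finset ℕ} {A B : Finset V}
    (hI : ∀ i ∈ I, s ≤ i ∧ i ≤ m) (hJ : ∀ i ∈ J, s ≤ i ∧ i ≤ m) (hIJ : Disjoint I J)
    (hA : ∀ z ∈ A, ∀ i, s ≤ i → i ≤ m → f i ≠ z)
    (hB : ∀ z ∈ B, ∀ i, s ≤ i → i ≤ m → f i ≠ z) (hAB : Disjoint A B)
    (ha : a ≤ #I + #A) (hb : b ≤ #J + #B) :
    (∃ i ∈ I, ∃ j ∈ J, G.Adj (f i) (f j)) ∨ (∃ i ∈ I, ∃ w ∈ B, G.Adj (f i) w) ∨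
      (∃ z ∈ A, ∃ j ∈ J, G.Adj z (f j)) ∨ ∃ z ∈ A, ∃ w ∈ B, G.Adj z w := by
  have hcard : ∀ (K : Finset ℕ) (C : Finset V), (∀ i ∈ K, s ≤ i ∧ i ≤ m) →
      (∀ z ∈ C, ∀ i, s ≤ i → i ≤ m → f i ≠ z) → #(K.image f ∪ C) = #K + #C := by
    intro K C hK hC
    rw [card_union_of_disjoint, card_image_of_injOn]
    · exact hf.mono fun i hi => hK i hi
    · rw [Finset.disjoint_left]
      intro v hv hvC
      obtain ⟨i, hi, rfl⟩ := mem_image.1 hv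
      exact hC _ hvC i (hK i hi).1 (hK i hi).2 rfl
  obtain ⟨u, hu, v, hv, huv⟩ := h.exists_adj (A := I.image f ∪ A) (B := J.image f ∪ B)
    (by rwa [hcard I A hI hA]) (by rwa [hcard J B hJ hB]) (by
      rw [Finset.disjoint_left]
      intro v hv hv'
      rw [mem_union, mem_image] at hv hv'
      rcases hv with ⟨i, hi, rfl⟩ | hv
      · rcases hv' with ⟨j, hj, hij⟩ | hv'
        · have := hf (hJ j hj) (hI i hi) hij
          subst this
          exact Finset.disjoint_left.1 hIJ hi hj
        · exact hB _ hv' i (hI i hi).1 (hI i hi).2 rfl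
      · rcases hv' with ⟨j, hj, rfl⟩ | hv'
        · exact hA _ hv j (hJ j hj).1 (hJ j hj).2 rfl
        · exact Finset.disjoint_left.1 hAB hv hv')
  rw [mem_union, mem_image] at hu hv
  rcases hu with ⟨i, hi, rfl⟩ | hu <;> rcases hv with ⟨j, hj, rfl⟩ | hv
  · exact Or.inl ⟨i, hi, j, hj, huv⟩
  · exact Or.inr (Or.inl ⟨i, hi, v, hv, huv⟩)
  · exact Or.inr (Or.inr (Or.inl ⟨u, hu, j, hj, huv⟩))
  · exact Or.inr (Or.inr (Or.inr ⟨u, hu, v, hv, huv⟩))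

open Classical in
/-- The indices `i ≤ m` for which `f i` is a neighbour of `v`. -/
noncomputable def nbrIdx (G : SimpleGraph V) (f : ℕ → V) (m : ℕ) (v : V) : Finset ℕ :=
  {i ∈ Icc 1 m | G.Adj v (f i)}

theorem mem_nbrIdx {f : ℕ → V} {m : ℕ} {v : V} {i : ℕ} :
    i ∈ G.nbrIdx f m v ↔ (1 ≤ i ∧ i ≤ m) ∧ G.Adj v (f i) := by
  classical
  simp [nbrIdx]

open Classical in
/-- The neighbours of `v` not among `f 1, …, f m`. -/
noncomputable def nbrOut [Fintype V] (G : SimpleGraph V) (f : ℕ → V) (m : ℕ) (v : V) :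
    Finset V := {z | G.Adj v z ∧ Avoids f m z}

theorem mem_nbrOut [Fintype V] {f : ℕ → V} {m : ℕ} {v z : V} :
    z ∈ G.nbrOut f m v ↔ G.Adj v z ∧ Avoids f m z := by
  classical
  simp [nbrOut]

theorem ncard_neighborSet_le [Fintype V] (f : ℕ → V) (m : ℕ) (v : V) :
    (G.neighborSet v).ncard ≤ #(G.nbrIdx f m v) + #(G.nbrOut f m v) := by
  classical
  have hsub : G.neighborSet v ⊆ ((G.nbrIdx f m v).image f ∪ G.nbrOut f m v : Finset V) := by
    intro z hz
    rw [mem_neighborSet] at hz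
    rw [coe_union, Set.mem_union, mem_coe, mem_coe, mem_image, mem_nbrOut]
    by_cases h : Avoids f m z
    · exact Or.inr ⟨hz, h⟩
    · unfold Avoids at h
      push Not at h
      obtain ⟨i, h1, h2, rfl⟩ := h
      exact Or.inl ⟨i, mem_nbrIdx.2 ⟨⟨h1, h2⟩, hz⟩, rfl⟩
  calc _ ≤ _ := Set.ncard_le_ncard hsub (Finset.finite_toSet _)
    _ = _ := Set.ncard_coe_finset _
    _ ≤ _ := card_union_le _ _
    _ ≤ _ := Nat.add_le_add_right card_image_le _

/-- The threshold `p` is the `c`-th smallest element of `S`. -/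
theorem exists_card_filter_le_eq (S : Finset ℕ) {c : ℕ} (hc : 1 ≤ c) (hS : c ≤ #S) :
    ∃ p ∈ S, #{i ∈ S | i ≤ p} = c := by
  induction S using Finset.induction_on_max with
  | empty => simp at hS; omega
  | insert x S hx ih =>
    have hxS : x ∉ S := fun h => lt_irrefl _ (hx x h)
    rw [card_insert_of_notMem hxS] at hS
    rcases hS.eq_or_lt with rfl | hlt
    · refine ⟨x, mem_insert_self _ _, ?_⟩
      rw [filter_true_of_mem, card_insert_of_notMem hxS]
      intro i hi
      rcases mem_insert.1 hi with rfl | hi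
      · exact le_rfl
      · exact (hx i hi).le
    · obtain ⟨p, hp, hpc⟩ := ih (by omega)
      refine ⟨p, mem_insert_of_mem hp, ?_⟩
      rw [filter_insert, if_neg (by have := hx p hp; omega), hpc]

theorem card_filter_lt_add_card_filter_ge (S : Finset ℕ) (p : ℕ) :
    #{i ∈ S | i < p} + #{i ∈ S | p ≤ i} = #S := by
  rw [← card_filter_add_card_filter_not (s := S) (fun i => i < p)]
  simp only [not_lt]

theorem card_filter_le_eq_add_one {S : Finset ℕ} {p : ℕ} (hp : p ∈ S) :
    #{i ∈ S | i ≤ p} = #{i ∈ S | i < p} + 1 := by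
  rw [← card_insert_of_notMem (s := {i ∈ S | i < p}) (a := p) (by simp)]
  congr 1
  ext i
  simp only [mem_filter, mem_insert]
  constructor
  · rintro ⟨h1, h2⟩
    rcases h2.eq_or_lt with rfl | h
    · exact Or.inl rfl
    · exact Or.inr ⟨h1, h⟩
  · rintro (rfl | h)
    · exact ⟨hp, le_rfl⟩
    · exact ⟨h.1, h.2.le⟩

theorem card_image_pred {S : Finset ℕ} (h : ∀ i ∈ S, 1 ≤ i) : #(S.image (· - 1)) = #S := by
  apply card_image_of_injOn
  intro i hi j hj hij
  have := h i hi
  have := h j hj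
  dsimp at hij
  omega

theorem card_image_succ (S : Finset ℕ) : #(S.image (· + 1)) = #S :=
  card_image_of_injective _ (add_left_injective 1)

/-! ### From a triangle path to a cycle on equally many vertices. -/

namespace TriPath

variable [Fintype V] {a b m : ℕ} {f : ℕ → V}

theorem hasCycle_of_card_nbrOut_lt (hf : G.TriPath m f) (hm : 4 ≤ m)
    (hab : G.EdgeBetweenDisjoint a b) (hdeg : ∀ v, a + b ≤ (G.neighborSet v).ncard + 1)
    (hb : 1 ≤ b) (hlt : #(G.nbrOut f m (f 1)) < a) : G.HasCycle m := by
  classical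
  by_contra hC
  have h1m : ¬ G.Adj (f 1) (f m) := fun h => hC (hf.hasCycle_of_adj_one h)
  set X := G.nbrIdx f m (f 1) with hX
  set Y := G.nbrIdx f m (f m) with hY
  have hXdeg := (hdeg (f 1)).trans (Nat.add_le_add_right (ncard_neighborSet_le f m (f 1)) 1)
  have hYdeg := (hdeg (f m)).trans (Nat.add_le_add_right (ncard_neighborSet_le f m (f m)) 1)
  rw [← hX] at hXdeg
  rw [← hY] at hYdeg
  have hXm : ∀ i ∈ X, 2 ≤ i ∧ i < m ∧ G.Adj (f 1) (f i) := by
    intro i hi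
    obtain ⟨⟨h1, h2⟩, h⟩ := mem_nbrIdx.1 hi
    refine ⟨?_, ?_, h⟩
    · rcases h1.eq_or_lt with rfl | h1
      · exact absurd h (G.loopless.irrefl _)
      · exact h1
    · rcases h2.eq_or_lt with rfl | h2
      · exact absurd h h1m
      · exact h2
  have hYm : ∀ i ∈ Y, 2 ≤ i ∧ i < m ∧ G.Adj (f m) (f i) := by
    intro i hi
    obtain ⟨⟨h1, h2⟩, h⟩ := mem_nbrIdx.1 hi
    refine ⟨?_, ?_, h⟩
    · rcases h1.eq_or_lt with rfl | h1
      · exact absurd h.symm h1m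
      · exact h1
    · rcases h2.eq_or_lt with rfl | h2
      · exact absurd h (G.loopless.irrefl _)
      · exact h2
  -- The elements of `X` up to `p`, with the outside neighbours of `f 1`, number exactly `a`. As `p`
  -- is counted on both sides of the cut, at least `b` elements of `X` are `≥ p`.
  obtain ⟨p, hpX, hp⟩ := exists_card_filter_le_eq X (c := a - #(G.nbrOut f m (f 1)))
    (by omega) (by omega)
  have hXp := card_filter_le_eq_add_one hpX
  have hXs := card_filter_lt_add_card_filter_ge X p
  have hYs := card_filter_lt_add_card_filter_ge Y p
  have hp2 := hXm p hpX
  by_cases hYb : b ≤ #{i ∈ Y | p ≤ i}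
  · rcases hab.exists_adj_seq hf.inj (I := {i ∈ X | i ≤ p}.image (· - 1))
      (J := {i ∈ Y | p ≤ i}.image (· + 1)) (A := G.nbrOut f m (f 1)) (B := ∅)
      (by
        simp only [mem_image, mem_filter]
        rintro _ ⟨i, ⟨hi, hip⟩, rfl⟩
        have := hXm i hi
        omega)
      (by
        simp only [mem_image, mem_filter]
        rintro _ ⟨i, ⟨hi, hip⟩, rfl⟩
        have := hYm i hi
        omega)
      (by
        rw [Finset.disjoint_left]
        simp only [mem_image, mem_filter]
        rintro _ ⟨i, ⟨hi, hip⟩, rfl⟩ ⟨j, ⟨hj, hjp⟩, hij⟩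
        omega)
      (fun z hz => (mem_nbrOut.1 hz).2) (by simp) (by simp)
      (by
        rw [card_image_pred (fun i hi => by have := hXm i (mem_filter.1 hi).1; omega)]
        omega)
      (by rw [card_image_succ]; simpa using hYb) with h | h | h | h
    · simp only [mem_image, mem_filter] at h
      obtain ⟨_, ⟨i, ⟨hi, hip⟩, rfl⟩, _, ⟨j, ⟨hj, hjp⟩, rfl⟩, hadj⟩ := h
      have hi' := hXm i hi
      have hj' := hYm j hj
      refine hC (hf.hasCycle_pred_succ (i := i - 1) (j := j) (by omega) (by omega) hj'.2.1 ?_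
        hj'.2.2 hadj)
      rw [show i - 1 + 1 = i by omega]
      exact hi'.2.2
    · simp at h
    · simp only [mem_image, mem_filter] at h
      obtain ⟨z, hz, _, ⟨j, ⟨hj, hjp⟩, rfl⟩, hadj⟩ := h
      have hj' := hYm j hj
      obtain ⟨hz1, hz2⟩ := mem_nbrOut.1 hz
      exact hC (hf.hasCycle_out_succ hz2 (by omega) hj'.2.1 hz1 hj'.2.2 hadj)
    · simp at h
  -- Fewer than `b` elements of `Y` are `≥ p`, so those below `p`, with the outside neighbours of `f
  -- m`, number at least `a`. Predecessors are now taken on both sides.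
  · rcases hab.symm.exists_adj_seq hf.inj (I := {i ∈ X | p ≤ i}.image (· - 1))
      (J := {i ∈ Y | i < p}.image (· - 1)) (A := ∅) (B := G.nbrOut f m (f m))
      (by
        simp only [mem_image, mem_filter]
        rintro _ ⟨i, ⟨hi, hip⟩, rfl⟩
        have := hXm i hi
        omega)
      (by
        simp only [mem_image, mem_filter]
        rintro _ ⟨i, ⟨hi, hip⟩, rfl⟩
        have := hYm i hi
        omega)
      (by
        rw [Finset.disjoint_left]
        simp only [mem_image, mem_filter]
        rintro _ ⟨i, ⟨hi, hip⟩, rfl⟩ ⟨j, ⟨hj, hjp⟩, hij⟩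
        have := hYm j hj
        omega)
      (by simp) (fun z hz => (mem_nbrOut.1 hz).2) (by simp)
      (by
        rw [card_image_pred (fun i hi => by have := hXm i (mem_filter.1 hi).1; omega)]
        simp only [card_empty]
        omega)
      (by
        rw [card_image_pred (fun i hi => by have := hYm i (mem_filter.1 hi).1; omega)]
        omega) with h | h | h | h
    · simp only [mem_image, mem_filter] at h
      obtain ⟨_, ⟨i, ⟨hi, hip⟩, rfl⟩, _, ⟨j, ⟨hj, hjp⟩, rfl⟩, hadj⟩ := h
      have hi' := hXm i hi
      have hj' := hYm j hj
      refine hC (hf.hasCycle_pred_pred (i := i - 1) (j := j) (by omega) (by omega) (by omega) ?_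
        hj'.2.2 hadj.symm)
      rw [show i - 1 + 1 = i by omega]
      exact hi'.2.2
    · simp only [mem_image, mem_filter] at h
      obtain ⟨_, ⟨i, ⟨hi, hip⟩, rfl⟩, w, hw, hadj⟩ := h
      have hi' := hXm i hi
      obtain ⟨hw1, hw2⟩ := mem_nbrOut.1 hw
      refine hC (hf.hasCycle_pred_out hw2 hm (i := i - 1) (by omega) (by omega) ?_ hw1 hadj)
      rw [show i - 1 + 1 = i by omega]
      exact hi'.2.2
    · simp at h
    · simp at h

theorem hasCycle_succ_of_le_card_nbrOut (hf : G.TriPath m f)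
    (hab : G.EdgeBetweenDisjoint a b) (hdeg : ∀ v, a + b ≤ (G.neighborSet v).ncard + 1)
    (ha : 1 ≤ a) (hle : a ≤ #(G.nbrOut f m (f 1))) : G.HasCycle (m + 1) := by
  classical
  by_contra hC
  have hXdeg := (hdeg (f 1)).trans (Nat.add_le_add_right (ncard_neighborSet_le f m (f 1)) 1)
  have hYdeg := (hdeg (f m)).trans (Nat.add_le_add_right (ncard_neighborSet_le f m (f m)) 1)
  set X := G.nbrIdx f m (f 1) with hX
  set Y := G.nbrIdx f m (f m) with hY
  have hXm : ∀ i ∈ X, 2 ≤ i ∧ i ≤ m ∧ G.Adj (f 1) (f i) := by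
    intro i hi
    obtain ⟨⟨h1, h2⟩, h⟩ := mem_nbrIdx.1 hi
    refine ⟨?_, h2, h⟩
    rcases h1.eq_or_lt with rfl | h1
    · exact absurd h (G.loopless.irrefl _)
    · exact h1
  have hYm : ∀ i ∈ Y, 1 ≤ i ∧ i < m ∧ G.Adj (f m) (f i) := by
    intro i hi
    obtain ⟨⟨h1, h2⟩, h⟩ := mem_nbrIdx.1 hi
    refine ⟨h1, ?_, h⟩
    rcases h2.eq_or_lt with rfl | h2
    · exact absurd h (G.loopless.irrefl _)
    · exact h2
  -- Otherwise `f m` has at least `b` neighbours on the path, and an edge from their successors to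
  -- the outside neighbours of `f 1` closes a cycle.
  have hW : a ≤ #(G.nbrOut f m (f m)) := by
    by_contra hlt
    rcases hab.exists_adj_seq hf.inj (I := ∅) (J := Y.image (· + 1))
      (A := G.nbrOut f m (f 1)) (B := ∅) (by simp)
      (by
        simp only [mem_image]
        rintro _ ⟨i, hi, rfl⟩
        have := hYm i hi
        omega)
      (by simp) (fun z hz => (mem_nbrOut.1 hz).2) (by simp) (by simp)
      (by simpa using hle)
      (by rw [card_image_succ, card_empty]; omega) with h | h | h | h
    · simp at h
    · simp at h
    · simp only [mem_image] at h
      obtain ⟨z, hz, _, ⟨j, hj, rfl⟩, hadj⟩ := h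
      have hj' := hYm j hj
      obtain ⟨hz1, hz2⟩ := mem_nbrOut.1 hz
      exact hC (hf.hasCycle_succ_of_out_succ hz2 (by omega) hj'.2.1 hz1 hj'.2.2 hadj)
    · simp at h
  rcases hab.exists_adj_seq hf.inj (I := ∅) (J := X.image (· - 1))
      (A := G.nbrOut f m (f m)) (B := G.nbrOut f m (f 1)) (by simp)
      (by
        simp only [mem_image]
        rintro _ ⟨i, hi, rfl⟩
        have := hXm i hi
        omega)
      (by simp) (fun z hz => (mem_nbrOut.1 hz).2) (fun z hz => (mem_nbrOut.1 hz).2)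
      (by
        rw [Finset.disjoint_left]
        intro z hz hz'
        rw [mem_nbrOut] at hz hz'
        exact hC (hf.hasCycle_succ_of_common hz.2 hz'.1 hz.1))
      (by simpa using hW)
      (by
        rw [card_image_pred (fun i hi => by have := hXm i hi; omega)]
        omega) with h | h | h | h
  · simp at h
  · simp at h
  · simp only [mem_image] at h
    obtain ⟨w, hw, _, ⟨i, hi, rfl⟩, hadj⟩ := h
    have hi' := hXm i hi
    obtain ⟨hw1, hw2⟩ := mem_nbrOut.1 hw
    refine hC (hf.hasCycle_succ_of_pred_out hw2 (i := i - 1) (by omega) (by omega) ?_ hw1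
      hadj.symm)
    rw [show i - 1 + 1 = i by omega]
    exact hi'.2.2
  · obtain ⟨w, hw, z, hz, hadj⟩ := h
    rw [mem_nbrOut] at hz hw
    exact hC (hf.hasCycle_succ_of_out_out hz.2 hw.2 hz.1 hw.1 hadj.symm)

/-- A path on `m` vertices starting with a triangle yields a cycle of length `m`. -/
theorem hasCycle (hf : G.TriPath m f) (hm : 4 ≤ m)
    (hab : G.EdgeBetweenDisjoint a b) (hdeg : ∀ v, a + b ≤ (G.neighborSet v).ncard + 1)
    (ha : 1 ≤ a) (hb : 1 ≤ b) : G.HasCycle m := by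
  by_cases hlt : #(G.nbrOut f m (f 1)) < a
  · exact hf.hasCycle_of_card_nbrOut_lt hm hab hdeg hb hlt
  -- Dropping `f m` keeps all outside neighbours of `f 1`, so the shorter path gives a cycle of
  -- length `(m - 1) + 1`.
  · have hsub : G.nbrOut f m (f 1) ⊆ G.nbrOut f (m - 1) (f 1) := by
      intro z hz
      rw [mem_nbrOut] at hz ⊢
      exact ⟨hz.1, fun i h1 h2 => hz.2 i h1 (by omega)⟩
    have := (hf.pred (m' := m - 1) (by omega) (by omega)).hasCycle_succ_of_le_card_nbrOut hab hdeg
      ha ((not_lt.1 hlt).trans (card_le_card hsub))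
    rwa [show m - 1 + 1 = m by omega] at this

end TriPath

/-! ### Lengthening a triangle path by one vertex. -/

namespace TriPath

variable {a b m : ℕ} {f : ℕ → V}

theorem swap (hf : G.TriPath m f) : G.TriPath m (f ∘ Equiv.swap 1 2) := by
  have h3 := hf.le
  have h1 : (f ∘ Equiv.swap 1 2) 1 = f 2 := by simp
  have h2 : (f ∘ Equiv.swap 1 2) 2 = f 1 := by simp
  have hi : ∀ i, 3 ≤ i → (f ∘ Equiv.swap 1 2) i = f i := fun i hi => by
    rw [Function.comp_apply, Equiv.swap_apply_of_ne_of_ne (by omega) (by omega)]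
  refine ⟨?_, ?_, h3, ?_⟩
  · have hmaps : Set.MapsTo (Equiv.swap 1 2) (Set.Icc 1 m) (Set.Icc 1 m) := by
      intro i hi
      obtain ⟨h, h'⟩ := hi
      rcases (show i = 1 ∨ i = 2 ∨ 3 ≤ i by omega) with rfl | rfl | h
      · rw [Equiv.swap_apply_left]; exact ⟨by omega, by omega⟩
      · rw [Equiv.swap_apply_right]; exact ⟨by omega, by omega⟩
      · rw [Equiv.swap_apply_of_ne_of_ne (by omega) (by omega)]; exact ⟨by omega, by omega⟩
    exact hf.inj.comp (Equiv.injective _).injOn hmaps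
  · intro i hi1 him
    rcases (show i = 1 ∨ i = 2 ∨ 3 ≤ i by omega) with rfl | rfl | h
    · rw [h1, h2]; exact hf.adj12.symm
    · rw [h2, hi 3 le_rfl]; exact hf.tri
    · rw [hi i h, hi (i + 1) (by omega)]; exact hf.adj i hi1 him
  · rw [h1, hi 3 le_rfl]; exact hf.adj23

/-- The new initial triangle is `f m, f 1, f 2`. -/
theorem rotate (hf : G.TriPath m f) (h1 : G.Adj (f m) (f 1)) (h2 : G.Adj (f m) (f 2)) :
    G.TriPath m (fun i => if i = 1 then f m else f (i - 1)) := by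
  have h3 := hf.le
  refine ⟨?_, ?_, h3, ?_⟩
  · intro i hi j hj hij
    obtain ⟨hi1, hi2⟩ := hi
    obtain ⟨hj1, hj2⟩ := hj
    dsimp only at hij
    split_ifs at hij with h h' h'
    · omega
    · have := hf.inj ⟨by omega, by omega⟩ ⟨by omega, by omega⟩ hij
      omega
    · have := hf.inj ⟨by omega, by omega⟩ ⟨by omega, by omega⟩ hij
      omega
    · have := hf.inj ⟨by omega, by omega⟩ ⟨by omega, by omega⟩ hij
      omega
  · intro i hi1 hi2
    rcases hi1.eq_or_lt with rfl | hi
    · simpa using h1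
    · rw [if_neg (by omega), if_neg (by omega)]
      have := hf.adj (i - 1) (by omega) (by omega)
      rwa [show i - 1 + 1 = i + 1 - 1 by omega] at this
  · simpa using h2

/-- Appending a vertex to the tail of the path, after rerouting it. -/
theorem extend (hf : G.TriPath m f) {y : V} {n : ℕ} {S : Set V} (h : G.HasPath (f 3) y n S)
    (h1 : f 1 ∉ S) (h2 : f 2 ∉ S) (hn : m + 1 = n + 2) : ∃ g, G.TriPath (m + 1) g := by
  exact h.exists_triPath hf.adj12 hf.tri hf.adj23 h1 h2 hn

theorem extend_last (hf : G.TriPath m f) {z : V} (hz : Avoids f m z) (h : G.Adj (f m) z) :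
    ∃ g, G.TriPath (m + 1) g := by
  have h3 := hf.le
  have hz' : ∀ {i j}, 1 ≤ i → j ≤ m → z ∉ f '' Set.Icc i j := fun hi hj => hz.notMem hi hj
  refine hf.extend ((hf.up (i := 3) (j := m) (by omega) (by omega) le_rfl).append
    (HasPath.single z) h (Set.disjoint_singleton_right.2 (hz' (by omega) le_rfl))) ?_ ?_ (by omega)
  all_goals
    rintro (h | h)
    · exact hf.notMem (by omega) (by omega) (by omega) (by omega) (by omega) h
    · exact hz _ (by omega) (by omega) h

theorem extend_insert (hf : G.TriPath m f) {z : V} {i : ℕ} (hz : Avoids f m z) (hi : 3 ≤ i)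
    (him : i < m) (h : G.Adj z (f i)) (h' : G.Adj z (f (i + 1))) :
    ∃ g, G.TriPath (m + 1) g := by
  refine hf.extend (((hf.up (i := 3) (j := i) (by omega) (by omega) (by omega)).append
    (HasPath.single z) h.symm (Set.disjoint_singleton_right.2 (hz.notMem (by omega) (by omega)))
    ).append (hf.up (i := i + 1) (j := m) (by omega) (by omega) (by omega)) h' ?_) ?_ ?_ (by omega)
  · rw [Set.disjoint_union_left, Set.disjoint_singleton_left]
    exact ⟨hf.disj (by omega) (by omega) (by omega) (by omega) (by omega),
      hz.notMem (by omega) (by omega)⟩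
  all_goals
    rintro ((h | h) | h)
    · exact hf.notMem (by omega) (by omega) (by omega) (by omega) (by omega) h
    · exact hz _ (by omega) (by omega) h
    · exact hf.notMem (by omega) (by omega) (by omega) (by omega) (by omega) h

theorem extend_insert_first (hf : G.TriPath m f) {z : V} (hz : Avoids f m z)
    (h : G.Adj z (f 1)) (h' : G.Adj z (f 2)) : ∃ g, G.TriPath (m + 1) g := by
  have h3 := hf.le
  obtain ⟨g, hg⟩ := (hf.up (i := 2) (j := m) (by omega) (by omega) le_rfl).exists_triPath
    (m := m + 1) h.symm hf.adj12 h'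
    (hf.notMem (by omega) (by omega) (by omega) (by omega) (by omega))
    (hz.notMem (by omega) (by omega)) (by omega)
  exact ⟨g, hg⟩

/-- The path rerouted so as to end at `f (j + 1)`. -/
theorem rerouted (hf : G.TriPath m f) {j : ℕ} (hj : 3 ≤ j) (hjm : j < m)
    (hy : G.Adj (f m) (f j)) : G.HasPath (f 3) (f (j + 1)) (m - 2) (f '' Set.Icc 3 m) := by
  obtain ⟨p, hp, hl, hS⟩ := (hf.up (i := 3) (j := j) (by omega) (by omega) (by omega)).append
    (hf.down (i := j + 1) (j := m) (by omega) (by omega) le_rfl) hy.symm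
    (hf.disj (by omega) (by omega) (by omega) (by omega) (by omega))
  refine ⟨p, hp, by omega, fun v hv => ?_⟩
  rcases hS v hv with h | h
  · exact Set.image_mono (Set.Icc_subset_Icc le_rfl (by omega)) h
  · exact Set.image_mono (Set.Icc_subset_Icc (by omega) le_rfl) h

theorem extend_succ (hf : G.TriPath m f) {z : V} {j : ℕ} (hz : Avoids f m z) (hj : 3 ≤ j)
    (hjm : j < m) (hy : G.Adj (f m) (f j)) (h : G.Adj (f (j + 1)) z) :
    ∃ g, G.TriPath (m + 1) g := by
  refine hf.extend ((hf.rerouted hj hjm hy).append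
    (HasPath.single z) h (Set.disjoint_singleton_right.2 (hz.notMem (by omega) le_rfl))) ?_ ?_
    (by omega)
  all_goals
    rintro (h | h)
    · exact hf.notMem (by omega) (by omega) (by omega) (by omega) (by omega) h
    · exact hz _ (by omega) (by omega) h

/-- The triangle `f 1, z, f 3` replaces the old one, which frees `f 2` to be attached at the end of
the rerouted tail. -/
theorem extend_succ_two (hf : G.TriPath m f) {z : V} {j : ℕ} (hz : Avoids f m z) (hj : 3 ≤ j)
    (hjm : j < m) (hy : G.Adj (f m) (f j)) (h1 : G.Adj z (f 1)) (h3 : G.Adj z (f 3))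
    (h : G.Adj (f (j + 1)) (f 2)) : ∃ g, G.TriPath (m + 1) g := by
  have hne : f 1 ≠ f 2 := hf.adj12.ne
  obtain ⟨g, hg⟩ := ((hf.rerouted hj hjm hy).append
    (HasPath.single (f 2)) h (Set.disjoint_singleton_right.2
      (hf.notMem (by omega) (by omega) (by omega) (by omega) (by omega)))).exists_triPath
    (m := m + 1) h1.symm hf.tri h3
    (by
      rintro (h | h)
      · exact hf.notMem (by omega) (by omega) (by omega) (by omega) (by omega) h
      · exact hne h)
    (by
      rintro (h | h)
      · exact hz.notMem (by omega) (by omega) h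
      · exact hz 2 (by omega) (by omega) h.symm) (by omega)
  exact ⟨g, hg⟩

/-- New tail: `f 3 … f i, z, f j … f (i+1), f (j+1) … f m`. -/
theorem extend_insert_succ_succ (hf : G.TriPath m f) {z : V} {i j : ℕ} (hz : Avoids f m z)
    (hi : 3 ≤ i) (hij : i < j) (hjm : j < m) (hzi : G.Adj z (f i)) (hzj : G.Adj z (f j))
    (h : G.Adj (f (i + 1)) (f (j + 1))) : ∃ g, G.TriPath (m + 1) g := by
  refine hf.extend ((((hf.up (i := 3) (j := i) (by omega) (by omega) (by omega)).append
    (HasPath.single z) hzi.symm (Set.disjoint_singleton_right.2 (hz.notMem (by omega) (by omega)))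
    ).append (hf.down (i := i + 1) (j := j) (by omega) (by omega) (by omega)) hzj ?_).append
    (hf.up (i := j + 1) (j := m) (by omega) (by omega) (by omega)) h ?_) ?_ ?_ (by omega)
  · rw [Set.disjoint_union_left, Set.disjoint_singleton_left]
    exact ⟨hf.disj (by omega) (by omega) (by omega) (by omega) (by omega),
      hz.notMem (by omega) (by omega)⟩
  · rw [Set.disjoint_union_left, Set.disjoint_union_left, Set.disjoint_singleton_left]
    exact ⟨⟨hf.disj (by omega) (by omega) (by omega) (by omega) (by omega),
      hz.notMem (by omega) (by omega)⟩,
      hf.disj (by omega) (by omega) (by omega) (by omega) (by omega)⟩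
  all_goals
    rintro (((h | h) | h) | h)
    · exact hf.notMem (by omega) (by omega) (by omega) (by omega) (by omega) h
    · exact hz _ (by omega) (by omega) h
    · exact hf.notMem (by omega) (by omega) (by omega) (by omega) (by omega) h
    · exact hf.notMem (by omega) (by omega) (by omega) (by omega) (by omega) h

/-- New tail: `f 3 … f j, f m … f (i+1), f (j+1) … f i, z`. -/
theorem extend_succ_succ (hf : G.TriPath m f) {z : V} {i j : ℕ} (hz : Avoids f m z)
    (hj : 3 ≤ j) (hji : j < i) (him : i < m) (hy : G.Adj (f m) (f j)) (hzi : G.Adj z (f i))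
    (h : G.Adj (f (j + 1)) (f (i + 1))) : ∃ g, G.TriPath (m + 1) g := by
  refine hf.extend ((((hf.up (i := 3) (j := j) (by omega) (by omega) (by omega)).append
    (hf.down (i := i + 1) (j := m) (by omega) (by omega) (by omega)) hy.symm
    (hf.disj (by omega) (by omega) (by omega) (by omega) (by omega))).append
    (hf.up (i := j + 1) (j := i) (by omega) (by omega) (by omega)) h.symm ?_).append
    (HasPath.single z) hzi.symm ?_) ?_ ?_ (by omega)
  · rw [Set.disjoint_union_left]
    exact ⟨hf.disj (by omega) (by omega) (by omega) (by omega) (by omega),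
      hf.disj (by omega) (by omega) (by omega) (by omega) (by omega)⟩
  · rw [Set.disjoint_singleton_right]
    rintro ((h | h) | h)
    · exact hz.notMem (by omega) (by omega) h
    · exact hz.notMem (by omega) (by omega) h
    · exact hz.notMem (by omega) (by omega) h
  all_goals
    rintro (((h | h) | h) | h)
    · exact hf.notMem (by omega) (by omega) (by omega) (by omega) (by omega) h
    · exact hf.notMem (by omega) (by omega) (by omega) (by omega) (by omega) h
    · exact hf.notMem (by omega) (by omega) (by omega) (by omega) (by omega) h
    · exact hz _ (by omega) (by omega) h

/-- New tail: `f 3 … f (i-1), f (j+1) … f m, f j … f i, z`. -/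
theorem extend_pred_succ (hf : G.TriPath m f) {z : V} {i j : ℕ} (hz : Avoids f m z)
    (hi : 4 ≤ i) (hij : i ≤ j) (hjm : j < m) (hy : G.Adj (f m) (f j)) (hzi : G.Adj z (f i))
    (h : G.Adj (f (i - 1)) (f (j + 1))) : ∃ g, G.TriPath (m + 1) g := by
  refine hf.extend ((((hf.up (i := 3) (j := i - 1) (by omega) (by omega) (by omega)).append
    (hf.up (i := j + 1) (j := m) (by omega) (by omega) (by omega)) h
    (hf.disj (by omega) (by omega) (by omega) (by omega) (by omega))).append
    (hf.down (i := i) (j := j) (by omega) (by omega) (by omega)) hy ?_).append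
    (HasPath.single z) hzi.symm ?_) ?_ ?_ (by omega)
  · rw [Set.disjoint_union_left]
    exact ⟨hf.disj (by omega) (by omega) (by omega) (by omega) (by omega),
      hf.disj (by omega) (by omega) (by omega) (by omega) (by omega)⟩
  · rw [Set.disjoint_singleton_right]
    rintro ((h | h) | h)
    · exact hz.notMem (by omega) (by omega) h
    · exact hz.notMem (by omega) (by omega) h
    · exact hz.notMem (by omega) (by omega) h
  all_goals
    rintro (((h | h) | h) | h)
    · exact hf.notMem (by omega) (by omega) (by omega) (by omega) (by omega) h
    · exact hf.notMem (by omega) (by omega) (by omega) (by omega) (by omega) h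
    · exact hf.notMem (by omega) (by omega) (by omega) (by omega) (by omega) h
    · exact hz _ (by omega) (by omega) h

/-- The counting argument behind `extend_of_not_adj_both`: here `T` is a set of vertices off the
tail of the path to which no end of a rerouted path is adjacent. -/
theorem extend_of_card (hf : G.TriPath m f) (hab : G.EdgeBetweenDisjoint a b) (hb : 1 ≤ b)
    (hba : b ≤ a) {z : V} (hz : Avoids f m z) {T : Finset V}
    (hT : ∀ t ∈ T, ∀ i, 3 ≤ i → i ≤ m → f i ≠ t)
    (hTadj : ∀ t ∈ T, ∀ j, 3 ≤ j → j < m → G.Adj (f m) (f j) → ¬ G.Adj (f (j + 1)) t)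
    (hy1 : 1 ≤ #{i ∈ G.nbrIdx f m (f m) | 3 ≤ i})
    (hy : a + b ≤ #{i ∈ G.nbrIdx f m (f m) | 3 ≤ i} + 2)
    (hν : a + b ≤ #{i ∈ G.nbrIdx f m z | 4 ≤ i} + #T + 1) :
    ∃ g, G.TriPath (m + 1) g := by
  classical
  by_contra hC
  set Y := {i ∈ G.nbrIdx f m (f m) | 3 ≤ i} with hY
  set Z := {i ∈ G.nbrIdx f m z | 4 ≤ i} with hZ
  have hYm : ∀ i ∈ Y, 3 ≤ i ∧ i < m ∧ G.Adj (f m) (f i) := by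
    intro i hi
    obtain ⟨hi, h3⟩ := mem_filter.1 hi
    obtain ⟨⟨h1, h2⟩, h⟩ := mem_nbrIdx.1 hi
    refine ⟨h3, ?_, h⟩
    rcases h2.eq_or_lt with rfl | h2
    · exact absurd h (G.loopless.irrefl _)
    · exact h2
  have hZm : ∀ i ∈ Z, 4 ≤ i ∧ i < m ∧ G.Adj z (f i) := by
    intro i hi
    obtain ⟨hi, h3⟩ := mem_filter.1 hi
    obtain ⟨⟨h1, h2⟩, h⟩ := mem_nbrIdx.1 hi
    refine ⟨h3, ?_, h⟩
    rcases h2.eq_or_lt with rfl | h2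
    · exact absurd (hf.extend_last hz h.symm) hC
    · exact h2
  have hinj : Set.InjOn f (Set.Icc 3 m) := hf.inj.mono (Set.Icc_subset_Icc_left (by omega))
  -- There are `b` successors to play against `T`: `#Y ≥ a + b - 2 ≥ b` if `a ≥ 2`, while `a = 1`
  -- forces `b = 1 ≤ #Y`.
  have hTa : #T < a := by
    by_contra hle
    rcases hab.exists_adj_seq hinj (I := ∅) (J := Y.image (· + 1)) (A := T) (B := ∅) (by simp)
      (by
        simp only [mem_image]
        rintro _ ⟨i, hi, rfl⟩
        have := hYm i hi
        omega) (by simp) hT (by simp) (by simp) (by simpa using hle)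
      (by rw [card_image_succ, card_empty]; omega) with h | h | h | h
    · simp at h
    · simp at h
    · simp only [mem_image] at h
      obtain ⟨t, ht, _, ⟨j, hj, rfl⟩, hadj⟩ := h
      have hj' := hYm j hj
      exact hTadj t ht j hj'.1 hj'.2.1 hj'.2.2 hadj.symm
    · simp at h
  obtain ⟨p, hpZ, hp⟩ := exists_card_filter_le_eq Z (c := a - #T) (by omega) (by omega)
  have hpm := hZm p hpZ
  have hYs := card_filter_lt_add_card_filter_ge Y p
  have hZs := card_filter_lt_add_card_filter_ge Z (p + 1)
  simp only [Nat.lt_succ_iff, Nat.succ_le_iff] at hZs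
  have hYp : #{i ∈ Y | p ≤ i} < b := by
    by_contra hle
    rcases hab.exists_adj_seq hinj (I := {i ∈ Z | i ≤ p}.image (· - 1))
      (J := {i ∈ Y | p ≤ i}.image (· + 1)) (A := T) (B := ∅)
      (by
        simp only [mem_image, mem_filter]
        rintro _ ⟨i, ⟨hi, hip⟩, rfl⟩
        have := hZm i hi
        omega)
      (by
        simp only [mem_image, mem_filter]
        rintro _ ⟨i, ⟨hi, hip⟩, rfl⟩
        have := hYm i hi
        omega)
      (by
        rw [Finset.disjoint_left]
        simp only [mem_image, mem_filter]
        rintro _ ⟨i, ⟨hi, hip⟩, rfl⟩ ⟨j, ⟨hj, hjp⟩, hij⟩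
        omega) hT (by simp) (by simp)
      (by
        rw [card_image_pred (fun i hi => by have := hZm i (mem_filter.1 hi).1; omega)]
        omega)
      (by rw [card_image_succ, card_empty]; omega) with h | h | h | h
    · simp only [mem_image, mem_filter] at h
      obtain ⟨_, ⟨i, ⟨hi, hip⟩, rfl⟩, _, ⟨j, ⟨hj, hjp⟩, rfl⟩, hadj⟩ := h
      have hi' := hZm i hi
      have hj' := hYm j hj
      exact hC (hf.extend_pred_succ hz hi'.1 (hip.trans hjp) hj'.2.1 hj'.2.2 hi'.2.2 hadj)
    · simp at h
    · simp only [mem_image, mem_filter] at h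
      obtain ⟨t, ht, _, ⟨j, ⟨hj, -⟩, rfl⟩, hadj⟩ := h
      have hj' := hYm j hj
      exact hTadj t ht j hj'.1 hj'.2.1 hj'.2.2 hadj.symm
    · simp at h
  -- Here `Y` has at least `a - 1` elements below `p` and `Z` at least `b - 1` above it. Adding `p`
  -- to the first set and the vertex `z` to the second makes up the missing units.
  rcases hab.exists_adj_seq hinj (I := (insert p {i ∈ Y | i < p}).image (· + 1))
      (J := {i ∈ Z | p < i}.image (· + 1)) (A := ∅) (B := {z})
      (by
        simp only [mem_image, mem_filter, mem_insert]
        rintro _ ⟨i, rfl | ⟨hi, hip⟩, rfl⟩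
        · omega
        · have := hYm i hi
          omega)
      (by
        simp only [mem_image, mem_filter]
        rintro _ ⟨i, ⟨hi, hip⟩, rfl⟩
        have := hZm i hi
        omega)
      (by
        rw [Finset.disjoint_left]
        simp only [mem_image, mem_filter, mem_insert]
        rintro _ ⟨i, hi, rfl⟩ ⟨j, ⟨hj, hjp⟩, hij⟩
        omega) (by simp)
      (by
        intro w hw i h1 h2
        rw [mem_singleton.1 hw]
        exact hz i (by omega) h2) (by simp)
      (by
        rw [card_image_succ, card_insert_of_notMem (by simp), card_empty]
        omega)
      (by
        rw [card_image_succ, card_singleton]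
        omega) with h | h | h | h
  · simp only [mem_image, mem_filter, mem_insert] at h
    obtain ⟨_, ⟨i, hi, rfl⟩, _, ⟨j, ⟨hj, hjp⟩, rfl⟩, hadj⟩ := h
    have hj' := hZm j hj
    rcases hi with rfl | ⟨hi, hip⟩
    · exact hC (hf.extend_insert_succ_succ hz (by omega) hjp hj'.2.1 hpm.2.2 hj'.2.2 hadj)
    · have hi' := hYm i hi
      exact hC (hf.extend_succ_succ hz hi'.1 (hip.trans hjp) hj'.2.1 hi'.2.2 hj'.2.2 hadj)
  · simp only [mem_image, mem_filter, mem_insert, mem_singleton, exists_eq_left] at h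
    obtain ⟨_, ⟨i, hi, rfl⟩, hadj⟩ := h
    rcases hi with rfl | ⟨hi, hip⟩
    · exact hC (hf.extend_insert hz (by omega) hpm.2.1 hpm.2.2 hadj.symm)
    · have hi' := hYm i hi
      exact hC (hf.extend_succ hz hi'.1 hi'.2.1 hi'.2.2 hadj)
  · simp at h
  · simp at h

/-- If every triangle path on `m` vertices can be rotated, each of its vertices becomes the last one
of some rotation, and a last vertex with a neighbour off the path allows an extension. -/
theorem not_adj_of_forall_rotate (hC : ¬ ∃ g, G.TriPath (m + 1) g)
    (hall : ∀ g, G.TriPath m g → G.Adj (g m) (g 1) ∧ G.Adj (g m) (g 2)) {z : V} (k : ℕ) :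
    ∀ f, G.TriPath m f → Avoids f m z → k < m → ¬ G.Adj (f (m - k)) z := by
  induction k with
  | zero => exact fun f hf hz _ h => hC (hf.extend_last hz h)
  | succ k ih =>
    intro f hf hz hk h
    refine ih _ (hf.rotate (hall f hf).1 (hall f hf).2) ?_ (by omega) ?_
    · intro i h1 h2
      dsimp only
      split_ifs
      · exact hz m (by omega) le_rfl
      · exact hz (i - 1) (by omega) (by omega)
    · rw [if_neg (by omega)]
      exact h

variable [Fintype V]

open Classical in
theorem extend_of_not_adj_both (hf : G.TriPath m f) (hab : G.EdgeBetweenDisjoint a b)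
    (hdeg : ∀ v, a + b ≤ (G.neighborSet v).ncard + 1) (hb : 1 ≤ b) (hba : b ≤ a) {z : V}
    (hz : Avoids f m z) (hnot : ¬ (G.Adj (f m) (f 1) ∧ G.Adj (f m) (f 2))) :
    ∃ g, G.TriPath (m + 1) g := by
  by_contra hC
  have h3 := hf.le
  have hm : 4 ≤ m := by
    rcases (show m = 3 ∨ 4 ≤ m by omega) with rfl | h
    · exact absurd ⟨hf.tri.symm, hf.adj23.symm⟩ hnot
    · exact h
  have hYdeg := (hdeg (f m)).trans (Nat.add_le_add_right (ncard_neighborSet_le f m (f m)) 1)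
  have hout : G.nbrOut f m (f m) = ∅ := by
    rw [eq_empty_iff_forall_notMem]
    intro w hw
    rw [mem_nbrOut] at hw
    exact hC (hf.extend_last hw.2 hw.1)
  rw [hout, card_empty] at hYdeg
  have hYs := card_filter_lt_add_card_filter_ge (G.nbrIdx f m (f m)) 3
  have hYlow : #{i ∈ G.nbrIdx f m (f m) | i < 3} ≤ 1 := by
    rw [card_le_one]
    intro i hi j hj
    rw [mem_filter, mem_nbrIdx] at hi hj
    by_contra hne
    rcases (show i = 1 ∧ j = 2 ∨ i = 2 ∧ j = 1 by omega) with ⟨rfl, rfl⟩ | ⟨rfl, rfl⟩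
    · exact hnot ⟨hi.1.2, hj.1.2⟩
    · exact hnot ⟨hj.1.2, hi.1.2⟩
  have hy1 : 1 ≤ #{i ∈ G.nbrIdx f m (f m) | 3 ≤ i} := by
    rw [Nat.one_le_iff_ne_zero, Finset.card_ne_zero]
    refine ⟨m - 1, mem_filter.2 ⟨mem_nbrIdx.2 ⟨⟨by omega, by omega⟩, ?_⟩, by omega⟩⟩
    have := hf.adj (m - 1) (by omega) (by omega)
    rw [show m - 1 + 1 = m by omega] at this
    exact this.symm
  set H : Finset V := {w | Avoids f m w} with hH
  have hmemH : ∀ {w}, w ∈ H ↔ Avoids f m w := by simp [hH]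
  -- The unit gained because `z` lies in `H` but is not its own neighbour offsets one neighbour of
  -- `z` among `f 1, f 2, f 3`.
  have hZout : #(G.nbrOut f m z) + 1 ≤ #H := by
    rw [← card_insert_of_notMem (a := z) (s := G.nbrOut f m z) (by simp [mem_nbrOut])]
    apply card_le_card
    intro w hw
    rw [mem_insert, mem_nbrOut] at hw
    rcases hw with rfl | hw
    · exact hmemH.2 hz
    · exact hmemH.2 hw.2
  have hZdeg := (hdeg z).trans (Nat.add_le_add_right (ncard_neighborSet_le f m z) 1)
  have hZs := card_filter_lt_add_card_filter_ge (G.nbrIdx f m z) 4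
  have hHadj : ∀ w, Avoids f m w → ∀ j, 3 ≤ j → j < m → G.Adj (f m) (f j) →
      ¬ G.Adj (f (j + 1)) w := fun w hw j hj hjm hy h => hC (hf.extend_succ hw hj hjm hy h)
  have hlow : ∀ {i}, i ∈ {i ∈ G.nbrIdx f m z | i < 4} ↔ (i = 1 ∨ i = 2 ∨ i = 3) ∧ G.Adj z (f i) := by
    intro i
    rw [mem_filter, mem_nbrIdx]
    constructor
    · rintro ⟨⟨h, h'⟩, h''⟩
      exact ⟨by omega, h'⟩
    · rintro ⟨h, h'⟩
      exact ⟨⟨by omega, h'⟩, by omega⟩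
  have h12 : ¬ (G.Adj z (f 1) ∧ G.Adj z (f 2)) := fun h =>
    hC (hf.extend_insert_first hz h.1 h.2)
  by_cases ht : #{i ∈ G.nbrIdx f m z | i < 4} ≤ 1
  · exact hC (hf.extend_of_card hab hb hba hz (T := H)
      (fun t ht i h1 h2 => hmemH.1 ht i (by omega) h2)
      (fun t ht => hHadj t (hmemH.1 ht)) hy1 (by omega) (by omega))
  have ht2 : #{i ∈ G.nbrIdx f m z | i < 4} ≤ 2 := by
    by_cases h1 : G.Adj z (f 1)
    · refine (card_le_card (t := {1, 3}) ?_).trans (card_le_two)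
      intro i hi
      obtain ⟨hi, hzi⟩ := hlow.1 hi
      rcases hi with rfl | rfl | rfl
      · simp
      · exact absurd ⟨h1, hzi⟩ h12
      · simp
    · refine (card_le_card (t := {2, 3}) ?_).trans (card_le_two)
      intro i hi
      obtain ⟨hi, hzi⟩ := hlow.1 hi
      rcases hi with rfl | rfl | rfl
      · exact absurd hzi h1
      · simp
      · simp
  -- With two neighbours there, `z` is adjacent to `f 3` and to exactly one of `f 1`, `f 2`. The
  -- other one is freed as in `extend_succ_two`, and adding it to `T` recovers the missing unit.
  obtain ⟨k, hk, hk2⟩ : ∃ k, (k = 1 ∨ k = 2) ∧ ∀ j, 3 ≤ j → j < m → G.Adj (f m) (f j) →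
      ¬ G.Adj (f (j + 1)) (f k) := by
    have hz3 : G.Adj z (f 3) := by
      by_contra h3
      apply ht
      rw [card_le_one]
      intro i hi j hj
      obtain ⟨hi, hzi⟩ := hlow.1 hi
      obtain ⟨hj, hzj⟩ := hlow.1 hj
      rcases hi with rfl | rfl | rfl <;> rcases hj with rfl | rfl | rfl <;> grind
    have hz12 : G.Adj z (f 1) ∨ G.Adj z (f 2) := by
      by_contra h
      apply ht
      rw [card_le_one]
      intro i hi j hj
      obtain ⟨hi, hzi⟩ := hlow.1 hi
      obtain ⟨hj, hzj⟩ := hlow.1 hj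
      rcases hi with rfl | rfl | rfl <;> rcases hj with rfl | rfl | rfl <;> grind
    rcases hz12 with h | h
    · exact ⟨2, Or.inr rfl, fun j hj hjm hy h' => hC (hf.extend_succ_two hz hj hjm hy h hz3 h')⟩
    · refine ⟨1, Or.inl rfl, fun j hj hjm hy h' => hC ?_⟩
      have hi : ∀ i, 3 ≤ i → (f ∘ Equiv.swap 1 2) i = f i := fun i hi => by
        rw [Function.comp_apply, Equiv.swap_apply_of_ne_of_ne (by omega) (by omega)]
      refine hf.swap.extend_succ_two (z := z) (j := j) ?_ hj hjm ?_ ?_ ?_ ?_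
      · intro i h1 h2
        rcases (show i = 1 ∨ i = 2 ∨ 3 ≤ i by omega) with rfl | rfl | h
        · simpa using hz 2 (by omega) (by omega)
        · simpa using hz 1 (by omega) (by omega)
        · rw [hi i h]; exact hz i h1 h2
      · rwa [hi m h3, hi j hj]
      · simpa using h
      · rwa [hi 3 le_rfl]
      · rw [hi (j + 1) (by omega)]; simpa using h'
  refine hC (hf.extend_of_card hab hb hba hz (T := insert (f k) H) ?_ ?_ hy1 (by omega) ?_)
  · intro t ht i h1 h2 hft
    rcases mem_insert.1 ht with rfl | ht
    · have := hf.inj ⟨by omega, h2⟩ ⟨by omega, by omega⟩ hft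
      omega
    · exact hmemH.1 ht i (by omega) h2 hft
  · intro t ht
    rcases mem_insert.1 ht with rfl | ht
    · exact hk2
    · exact hHadj t (hmemH.1 ht)
  · rw [card_insert_of_notMem (fun h => hmemH.1 h k (by omega) (by omega) rfl)]
    omega

open Classical in
theorem exists_succ (hf : G.TriPath m f) (hab : G.EdgeBetweenDisjoint a b)
    (hdeg : ∀ v, a + b ≤ (G.neighborSet v).ncard + 1) (hb : 1 ≤ b) (hba : b ≤ a)
    (hm : m < Fintype.card V) : ∃ g, G.TriPath (m + 1) g := by
  by_contra hC
  have h3 := hf.le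
  have hexists : ∀ g : ℕ → V, ∃ z, Avoids g m z := by
    intro g
    have : ((Icc 1 m).image g).card < Fintype.card V :=
      card_image_le.trans_lt (by simpa using hm)
    obtain ⟨z, hz⟩ := exists_mem_notMem_of_card_lt_card (s := (Icc 1 m).image g)
      (t := univ) (by simpa using this)
    refine ⟨z, fun i h1 h2 h => hz.2 ?_⟩
    exact mem_image.2 ⟨i, mem_Icc.2 ⟨h1, h2⟩, h⟩
  have hall : ∀ g, G.TriPath m g → G.Adj (g m) (g 1) ∧ G.Adj (g m) (g 2) := by
    intro g hg
    by_contra hnot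
    obtain ⟨z, hz⟩ := hexists g
    exact hC (hg.extend_of_not_adj_both hab hdeg hb hba hz hnot)
  have hno : ∀ i, 1 ≤ i → i ≤ m → ∀ z, Avoids f m z → ¬ G.Adj (f i) z := by
    intro i h1 h2 z hz
    have := not_adj_of_forall_rotate hC hall (z := z) (m - i) f hf hz (by omega)
    rwa [show m - (m - i) = i by omega] at this
  obtain ⟨z, hz⟩ := hexists f
  have hzdeg := (hdeg z).trans (Nat.add_le_add_right (ncard_neighborSet_le f m z) 1)
  have hfdeg := (hdeg (f 1)).trans (Nat.add_le_add_right (ncard_neighborSet_le f m (f 1)) 1)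
  have e1 : G.nbrIdx f m z = ∅ := by
    rw [eq_empty_iff_forall_notMem]
    intro i hi
    rw [mem_nbrIdx] at hi
    exact hno i hi.1.1 hi.1.2 z hz hi.2.symm
  have e2 : G.nbrOut f m (f 1) = ∅ := by
    rw [eq_empty_iff_forall_notMem]
    intro i hi
    rw [mem_nbrOut] at hi
    exact hno 1 le_rfl (by omega) i hi.2 hi.1
  rw [e1, card_empty] at hzdeg
  rw [e2, card_empty] at hfdeg
  have hle : #(G.nbrIdx f m (f 1)) ≤ m := by
    refine (card_le_card (t := Icc 1 m) ?_).trans (by simp)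
    intro i hi
    exact mem_Icc.2 (mem_nbrIdx.1 hi).1
  -- No edge leaves the path, yet it has at least `a + b - 1 ≥ a` vertices and `z` has at least `b`
  -- neighbours off it.
  rcases hab.exists_adj_seq hf.inj (I := Icc 1 m) (J := ∅) (A := ∅) (B := G.nbrOut f m z)
    (by simp) (by simp) (by simp) (by simp) (fun w hw => (mem_nbrOut.1 hw).2) (by simp)
    (by simp; omega) (by simp; omega) with h | h | h | h
  · simp at h
  · obtain ⟨i, hi, w, hw, hadj⟩ := h
    rw [mem_Icc] at hi
    exact hno i hi.1 hi.2 w (mem_nbrOut.1 hw).2 hadj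
  · simp at h
  · simp at h

/-- If `G` contains a triangle, some Hamilton path of `G` starts with a triangle. -/
theorem exists_card (hf : G.TriPath m f) (hab : G.EdgeBetweenDisjoint a b)
    (hdeg : ∀ v, a + b ≤ (G.neighborSet v).ncard + 1) (hb : 1 ≤ b) (hba : b ≤ a) :
    ∀ n, m ≤ n → n ≤ Fintype.card V → ∃ g, G.TriPath n g := by
  intro n hmn
  induction n, hmn using Nat.le_induction with
  | base => exact fun _ => ⟨f, hf⟩
  | succ n hmn ih =>
    intro hn
    obtain ⟨g, hg⟩ := ih (by omega)
    exact hg.exists_succ hab hdeg hb hba (by omega)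

end TriPath

/-! ### The triangle-free case. -/

theorem nonempty_iso_completeBipartiteGraph [Fintype V] {k : ℕ} (R : Finset V) (hR : #R = k)
    (hV : Fintype.card V = 2 * k)
    (hadj : ∀ x y, G.Adj x y ↔ (x ∈ R ∧ y ∉ R) ∨ (x ∉ R ∧ y ∈ R)) :
    Nonempty (G ≃g completeBipartiteGraph (Fin k) (Fin k)) := by
  classical
  have h1 : Fintype.card {v // v ∈ R} = k := by simpa using hR
  have h2 : Fintype.card {v // v ∉ R} = k := by
    rw [Fintype.card_subtype_compl, h1]; omega
  let e : Fin k ⊕ Fin k ≃ V :=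
    (Equiv.sumCongr (Fintype.equivFinOfCardEq h1).symm (Fintype.equivFinOfCardEq h2).symm).trans
      (Equiv.sumCompl (· ∈ R))
  have hl : ∀ i, e (Sum.inl i) ∈ R := fun i => ((Fintype.equivFinOfCardEq h1).symm i).2
  have hr : ∀ i, e (Sum.inr i) ∉ R := fun i => ((Fintype.equivFinOfCardEq h2).symm i).2
  refine ⟨(⟨e, ?_⟩ : completeBipartiteGraph (Fin k) (Fin k) ≃g G).symm⟩
  rintro (i | i) (j | j) <;> simp [hadj, hl, hr]

/-- A triangle-free graph satisfying the degree condition is complete bipartite. -/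
theorem exists_iso_completeBipartiteGraph [Fintype V] [Nonempty V] {a b : ℕ}
    (hab : G.EdgeBetweenDisjoint a b) (hdeg : ∀ v, a + b ≤ (G.neighborSet v).ncard + 1)
    (hb : 1 ≤ b) (hba : b ≤ a) (htri : ∀ x y z, G.Adj x y → G.Adj x z → ¬ G.Adj y z) :
    ∃ m : ℕ, Fintype.card V = 2 * m ∧
      Nonempty (G ≃g completeBipartiteGraph (Fin m) (Fin m)) := by
  classical
  have hN : ∀ v, (G.neighborSet v).ncard = #(G.neighborFinset v) := fun v => by
    rw [← Set.ncard_coe_finset, coe_neighborFinset]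
  simp only [hN] at hdeg
  have hcard : ∀ v, #(G.neighborFinset v) + 1 = a + b := by
    intro v
    refine le_antisymm ?_ (hdeg v)
    by_contra hlt
    obtain ⟨A, hA, hAa⟩ := exists_subset_card_eq (s := G.neighborFinset v) (n := a) (by omega)
    obtain ⟨x, hx, y, hy, hxy⟩ := hab.exists_adj (A := A) (B := G.neighborFinset v \ A) hAa.ge
      (by rw [card_sdiff_of_subset hA]; omega) disjoint_sdiff
    have hx' := hA hx
    have hy' := (mem_sdiff.1 hy).1
    rw [mem_neighborFinset] at hx' hy'
    exact htri v x y hx' hy' hxy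
  -- Otherwise `b` neighbours of `u` are not adjacent to `w`. The other `a - 1` neighbours of `u`
  -- together with `w` send no edge to them.
  have hinter : ∀ u w, ¬ G.Adj u w → a ≤ #(G.neighborFinset u ∩ G.neighborFinset w) := by
    intro u w huw
    by_contra hlt
    have hs := card_sdiff_add_card_inter (G.neighborFinset u) (G.neighborFinset w)
    have hu := hcard u
    obtain ⟨B, hB, hBb⟩ := exists_subset_card_eq
      (s := G.neighborFinset u \ G.neighborFinset w) (n := b) (by omega)
    have hBu : B ⊆ G.neighborFinset u := hB.trans sdiff_subset
    have hw : w ∉ G.neighborFinset u := by rwa [mem_neighborFinset]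
    obtain ⟨x, hx, y, hy, hxy⟩ := hab.exists_adj (A := insert w (G.neighborFinset u \ B)) (B := B)
      (by
        rw [card_insert_of_notMem (fun h => hw (mem_sdiff.1 h).1), card_sdiff_of_subset hBu]
        omega) hBb.ge (by
        rw [disjoint_insert_left]
        exact ⟨fun h => hw (hBu h), sdiff_disjoint⟩)
    have hy' := mem_sdiff.1 (hB hy)
    rw [mem_neighborFinset, mem_neighborFinset] at hy'
    rcases mem_insert.1 hx with rfl | hx
    · exact hy'.2 hxy
    · have hx' := (mem_sdiff.1 hx).1
      rw [mem_neighborFinset] at hx'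
      exact htri u x y hx' hy'.1 hxy
  -- If `u` and `z` were adjacent, their common neighbourhoods with `w` would be disjoint, giving `2
  -- * a ≤ a + b - 1` against `b ≤ a`.
  have htrans : ∀ u w z, ¬ G.Adj u w → ¬ G.Adj w z → ¬ G.Adj u z := by
    intro u w z huw hwz huz
    have h1 := hinter w u (fun h => huw h.symm)
    have h2 := hinter w z hwz
    have hw := hcard w
    have hd : Disjoint (G.neighborFinset w ∩ G.neighborFinset u)
        (G.neighborFinset w ∩ G.neighborFinset z) := by
      rw [Finset.disjoint_left]
      intro x hx hx'
      simp only [mem_inter, mem_neighborFinset] at hx hx'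
      exact htri u x z hx.2 huz hx'.2.symm
    have := card_le_card (union_subset (inter_subset_left (s₁ := G.neighborFinset w)
      (s₂ := G.neighborFinset u)) (inter_subset_left (s₁ := G.neighborFinset w)
      (s₂ := G.neighborFinset z)))
    rw [card_union_of_disjoint hd] at this
    omega
  obtain ⟨u⟩ := ‹Nonempty V›
  have hadj : ∀ x y, G.Adj x y ↔ (x ∈ G.neighborFinset u ∧ y ∉ G.neighborFinset u) ∨
      (x ∉ G.neighborFinset u ∧ y ∈ G.neighborFinset u) := by
    intro x y
    simp only [mem_neighborFinset]
    by_cases hx : G.Adj u x <;> by_cases hy : G.Adj u y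
    · simpa [hx, hy] using htri u x y hx hy
    · simp only [hx, hy, not_false_eq_true, and_self, not_true_eq_false, or_false, iff_true]
      by_contra h
      exact htrans u y x hy (fun h' => h h'.symm) hx
    · simp only [hx, hy, not_false_eq_true, and_self, not_true_eq_false, false_or,
        iff_true]
      by_contra h
      exact htrans u x y hx h hy
    · simpa [hx, hy] using htrans x u y (fun h => hx h.symm) hy
  have hu := hcard u
  obtain ⟨v, hv⟩ : (G.neighborFinset u).Nonempty := by
    rw [← card_pos]; omega
  have hcompl : G.neighborFinset v = (G.neighborFinset u)ᶜ := by
    ext w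
    rw [mem_compl, mem_neighborFinset, hadj]
    simp [hv]
  have hvc := hcard v
  have hV : #(G.neighborFinset u)ᶜ = Fintype.card V - #(G.neighborFinset u) := card_compl _
  have hle := card_le_univ (G.neighborFinset u)
  rw [hcompl] at hvc
  have hV2 : Fintype.card V = 2 * #(G.neighborFinset u) := by omega
  exact ⟨_, hV2, nonempty_iso_completeBipartiteGraph _ rfl hV2 hadj⟩

/-! ### Conclusion. -/

/-- A graph with a triangle satisfying the degree condition is pancyclic. -/
theorem isPancyclic_of_triangle [Fintype V] {a b : ℕ}
    (hab : G.EdgeBetweenDisjoint a b) (hdeg : ∀ v, a + b ≤ (G.neighborSet v).ncard + 1)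
    (hb : 1 ≤ b) (hba : b ≤ a) {x y z : V} (hxy : G.Adj x y) (hxz : G.Adj x z)
    (hyz : G.Adj y z) : G.IsPancyclic := by
  obtain ⟨f, hf⟩ := (HasPath.single z).exists_triPath (m := 3) hxy hxz hyz hxz.ne hyz.ne rfl
  intro l h3 hl
  obtain ⟨g, hg⟩ := hf.exists_card hab hdeg hb hba l h3 hl
  rcases h3.eq_or_lt with rfl | h4
  · exact hg.hasCycle_of_adj_one hg.tri
  · exact hg.hasCycle h4 hab hdeg (hb.trans hba) hb

end SimpleGraph

theorem theorem2 {V : Type*} [Fintype V] (G : SimpleGraph V) [DecidableRel G.Adj]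
    (hG : G.bipartiteIndepNum ≤ G.minDegree) :
    G.IsPancyclic ∨
      ∃ m : ℕ, Fintype.card V = 2 * m ∧
        Nonempty (G ≃g completeBipartiteGraph (Fin m) (Fin m)) := by
  rcases isEmpty_or_nonempty V with hV | hV
  · left
    intro l h3 hl
    rw [Fintype.card_eq_zero] at hl
    omega
  obtain ⟨a, b, ha, hb, hsum, hab⟩ := G.bipartiteIndepNum_spec
  have hdeg : ∀ v, a + b ≤ (G.neighborSet v).ncard + 1 := by
    intro v
    have h1 := G.minDegree_le_degree v
    have h2 : (G.neighborSet v).ncard = G.degree v := by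
      rw [← SimpleGraph.card_neighborFinset_eq_degree, ← Set.ncard_coe_finset,
        SimpleGraph.coe_neighborFinset]
    omega
  wlog hba : b ≤ a generalizing a b
  · exact this b a hb ha (by omega) hab.symm (fun v => by have := hdeg v; omega) (by omega)
  by_cases htri : ∀ x y z, G.Adj x y → G.Adj x z → ¬ G.Adj y z
  · exact Or.inr (SimpleGraph.exists_iso_completeBipartiteGraph hab hdeg hb hba htri)
  · push Not at htri
    obtain ⟨x, y, z, hxy, hxz, hyz⟩ := htri
    exact Or.inl (SimpleGraph.isPancyclic_of_triangle hab hdeg hb hba hxy hxz hyz)
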